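/- Let $(M,\omega)$ be a (Hausdorff, paracompact, finite-dimensional, $C^\infty$) symplectic manifold, let $G$ be a Lie group with Lie algebra $\mathfrak g$ acting smoothly on $M$ and preserving $\omega$, let $\underline\xi_x=\frac{d}{dt}\exp(-t\xi)x|_{t=0}$ be the fundamental vector fields, and let $\mu:M\to\mathfrak g^*$ be a moment map: $\mu$ is smooth, equivariant for the coadjoint action, and $d\mu_\xi=-\iota_{\underline\xi}\omega$ for $\mu_\xi=\langle\mu,\xi\rangle$, $\xi\in\mathfrak g$. Put $N=\mu^{-1}(0)$. For $f\in C^\infty(M)$ let $v_f$ be the vector field with $df=-\iota_{v_f}\omega$, and let $\{f,h\}=\omega(v_f,v_h)$. Let $I_N\subset C^\infty(M)$ be the ideal of functions vanishing on $N$, $I_{\mathfrak X}(N)=\{u\in\mathfrak X(M): u\,C^\infty(M)\subset I_N\}$, and $\mathfrak X_{\mathfrak g}(M)$ the $C^\infty(M)$-submodule of $\mathfrak X(M)$ generated by all $\underline\xi$. Let $L_\infty(M,\omega)_{[N]}$ be the set of $f\in C^\infty(M)$ such that, for all $\xi\in\mathfrak g$, $\underline\xi f\in I_N$, $v_f I_N\subset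 I_N$ and $[v_f,\underline\xi]\in\mathfrak X_{\mathfrak g}(M)+I_{\mathfrak X}(N)$; let $I_{L_\infty}(N)$ be the set of those $f\in L_\infty(M,\omega)_{[N]}$ with $f\in I_N$ and $v_f\in\mathfrak X_{\mathfrak g}(M)+I_{\mathfrak X}(N)$. Let $I_\mu$ be the ideal of $C^\infty(M)$ generated by all $\mu_\xi$, and put $$F_N=\{f:\{f,I_N\}\subset I_N\},\qquad \mathcal Q=\{f:\{f,C^\infty(M)\}\subset I_N\},\qquad \mathcal Q'=\{f:\{f,\mu_\xi\}\in I_\mu+\mathcal Q\ \ \forall\xi\in\mathfrak g\}.$$ Then $$L_\infty(M,\omega)_{[N]}=F_N\cap\mathcal Q',\qquad I_{L_\infty}(N)=I_\mu+(I_N\cap\mathcal Q).$$ Furthermore, the former is a subalgebra of $C^\infty(M)$ closed under $\{\cdot,\cdot\}$, the latter is an ideal of it, the bracket descends to the quotient, and the reduced Poisson algebra is $$\frac{L_\infty(M,\omega)_{[N]}}{I_{L_\infty}(N)}=\frac{F_N\cap\mathcal Q'}{I_\mu+(I_N\cap\mathcal Q)}.$$ -/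

import Mathlib

open scoped Manifold ContDiff Topology Pointwise
open Bundle VectorField

noncomputable section

namespace SymplecticReduction

section Manifold

variable (E : Type*) [NormedAddCommGroup E] [NormedSpace ℝ E]
  (M : Type*) [TopologicalSpace M] [ChartedSpace E M]

/-- The algebra `C^∞(M)` of smooth real functions. -/
abbrev SmoothFunction : Type _ := C^∞⟮𝓘(ℝ, E), M; ℝ⟯

/-- The space `𝔛(M)` of smooth vector fields. -/
abbrev SmoothVectorField [IsManifold 𝓘(ℝ, E) ∞ M] : Type _ :=
  Cₛ^∞⟮𝓘(ℝ, E); E, fun x : M => TangentSpace 𝓘(ℝ, E) x⟯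

/-- A smooth differential `2`-form, that is, a smooth section of the bundle of bilinear forms
on the tangent spaces which is alternating at every point. -/
structure TwoForm [IsManifold 𝓘(ℝ, E) ∞ M] where
  /-- the bilinear form at a point -/
  toFun (x : M) : TangentSpace 𝓘(ℝ, E) x →L[ℝ] TangentSpace 𝓘(ℝ, E) x →L[ℝ] ℝ
  alternating (x : M) (v : TangentSpace 𝓘(ℝ, E) x) : toFun x v v = 0
  smooth : ContMDiff 𝓘(ℝ, E) (𝓘(ℝ, E).prod 𝓘(ℝ, E →L[ℝ] E →L[ℝ] ℝ)) ∞
    (fun x => TotalSpace.mk' (E →L[ℝ] E →L[ℝ] ℝ)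
      (E := fun x : M => TangentSpace 𝓘(ℝ, E) x →L[ℝ] TangentSpace 𝓘(ℝ, E) x →L[ℝ] ℝ) x (toFun x))

variable {E M} [IsManifold 𝓘(ℝ, E) ∞ M]

/-- The differential `df` at the point `x`. -/
def differential (f : SmoothFunction E M) (x : M) : TangentSpace 𝓘(ℝ, E) x →L[ℝ] ℝ :=
  mfderiv 𝓘(ℝ, E) 𝓘(ℝ, ℝ) f x

theorem contMDiff_derivation (v : SmoothVectorField E M) (f : SmoothFunction E M) :
    ContMDiff 𝓘(ℝ, E) 𝓘(ℝ, ℝ) ∞ (fun x : M => differential f x (v x)) := by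
  have h := (f.contMDiff.contMDiff_tangentMap (m := ∞) (by simp)).comp v.contMDiff
  intro x
  have h2 := (contMDiffAt_totalSpace.1 (h x)).2
  simp only [tangentMap, Function.comp_def, trivializationAt_model_space_apply] at h2
  exact h2

/-- The derivative `v f` of a function `f` along a vector field `v`, also written `L_v f`. -/
def derivation (v : SmoothVectorField E M) (f : SmoothFunction E M) : SmoothFunction E M :=
  ⟨fun x => differential f x (v x), contMDiff_derivation v f⟩

theorem contMDiff_lieBracket [FiniteDimensional ℝ E] (v w : SmoothVectorField E M) :
    ContMDiff 𝓘(ℝ, E) 𝓘(ℝ, E).tangent ∞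
      (fun x : M => TotalSpace.mk' E x (mlieBracket 𝓘(ℝ, E) v w x)) := by
  have := FiniteDimensional.complete ℝ E
  have : IsManifold 𝓘(ℝ, E) (minSmoothness ℝ 2) M :=
    IsManifold.of_le (n := ∞) (by simpa using ENat.LEInfty.out)
  have : IsManifold 𝓘(ℝ, E) (((⊤ : ℕ∞) : WithTop ℕ∞) + 1) M :=
    IsManifold.of_le (n := ∞) (by simp)
  intro x
  exact ContMDiffAt.mlieBracket_vectorField (m := ⊤) (n := ⊤) (v.contMDiff x) (w.contMDiff x)
    (by simp)

/-- The Lie bracket `[v, w]` of vector fields, with `[v, w] f = v (w f) - w (v f)`. -/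
def lieBracket [FiniteDimensional ℝ E] (v w : SmoothVectorField E M) : SmoothVectorField E M :=
  ⟨fun x => mlieBracket 𝓘(ℝ, E) v w x, contMDiff_lieBracket v w⟩

/-- The product `g v` of a function and a vector field. -/
def fsmul (g : SmoothFunction E M) (v : SmoothVectorField E M) : SmoothVectorField E M :=
  ⟨fun x => g x • v x, g.contMDiff.smul_section v.contMDiff⟩

theorem TwoForm.contMDiff_pair (Ω : TwoForm E M) (v w : SmoothVectorField E M) :
    ContMDiff 𝓘(ℝ, E) 𝓘(ℝ, ℝ) ∞ (fun x : M => Ω.toFun x (v x) (w x)) := by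
  have h : ContMDiff 𝓘(ℝ, E) (𝓘(ℝ, E).prod 𝓘(ℝ, ℝ)) ∞
      (fun m ↦ TotalSpace.mk' ℝ (E := Bundle.Trivial M ℝ) m (Ω.toFun m (v m) (w m))) :=
    ContMDiff.clm_bundle_apply₂ (F₁ := E) (F₂ := E) Ω.smooth v.contMDiff w.contMDiff
  intro x
  have h2 := (contMDiffAt_totalSpace.1 (h x)).2
  exact h2

/-- The function `Ω(v, w)`. -/
def TwoForm.pair (Ω : TwoForm E M) (v w : SmoothVectorField E M) : SmoothFunction E M :=
  ⟨fun x => Ω.toFun x (v x) (w x), Ω.contMDiff_pair v w⟩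

variable (E M) in
/-- A symplectic form: a nondegenerate `2`-form `Ω` with `dΩ = 0`, where `dΩ` is given by the
invariant (Koszul) formula for the exterior derivative. -/
structure SymplecticForm [FiniteDimensional ℝ E] extends TwoForm E M where
  nondegenerate (x : M) (v : TangentSpace 𝓘(ℝ, E) x) : (∀ w, toFun x v w = 0) → v = 0
  closed (u v w : SmoothVectorField E M) :
    derivation u (toTwoForm.pair v w) - derivation v (toTwoForm.pair u w)
      + derivation w (toTwoForm.pair u v) - toTwoForm.pair (lieBracket u v) w
      + toTwoForm.pair (lieBracket u w) v - toTwoForm.pair (lieBracket v w) u = 0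

end Manifold

section Poisson

variable {E : Type*} [NormedAddCommGroup E] [NormedSpace ℝ E] [FiniteDimensional ℝ E]
  {M : Type*} [TopologicalSpace M] [ChartedSpace E M] [IsManifold 𝓘(ℝ, E) ∞ M]

theorem isInvertible_of_nondegenerate {V : Type*} [NormedAddCommGroup V] [NormedSpace ℝ V]
    [FiniteDimensional ℝ V] (B : V →L[ℝ] V →L[ℝ] ℝ)
    (hB : ∀ v, (∀ w, B v w = 0) → v = 0) : B.IsInvertible := by
  have hinj : Function.Injective (B : V →ₗ[ℝ] (V →L[ℝ] ℝ)) := by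
    rw [← LinearMap.ker_eq_bot, LinearMap.ker_eq_bot']
    intro v hv
    exact hB v fun w => by simpa using congrArg (fun l : V →L[ℝ] ℝ => l w) hv
  have hdim : Module.finrank ℝ V = Module.finrank ℝ (V →L[ℝ] ℝ) := by
    rw [← (LinearMap.toContinuousLinearMap (𝕜 := ℝ) (E := V) (F' := ℝ)).finrank_eq]
    exact (Subspace.dual_finrank_eq (K := ℝ) (V := V)).symm
  exact ⟨(LinearEquiv.ofInjectiveOfFinrankEq _ hinj hdim).toContinuousLinearEquiv, by ext; rfl⟩

theorem SymplecticForm.isInvertible (Ω : SymplecticForm E M) (x : M) :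
    (Ω.toFun x).IsInvertible :=
  isInvertible_of_nondegenerate (V := E) (Ω.toFun x) (Ω.nondegenerate x)

/-- The value at `x` of the Hamiltonian vector field of `f`: the unique vector `v` with
`Ω(v, ·) = -df` at `x`. -/
def SymplecticForm.hamiltonianVector (Ω : SymplecticForm E M) (f : SmoothFunction E M) (x : M) :
    TangentSpace 𝓘(ℝ, E) x :=
  -(Ω.toFun x).inverse (differential f x)

theorem SymplecticForm.apply_hamiltonianVector (Ω : SymplecticForm E M) (f : SmoothFunction E M)
    (x : M) (w : TangentSpace 𝓘(ℝ, E) x) :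
    Ω.toFun x (Ω.hamiltonianVector f x) w = -differential f x w := by
  obtain ⟨e, he⟩ := Ω.isInvertible x
  rw [SymplecticForm.hamiltonianVector, ← he, ContinuousLinearMap.inverse_equiv, map_neg]
  simp

theorem SymplecticForm.contMDiff_hamiltonianVector (Ω : SymplecticForm E M)
    (f : SmoothFunction E M) :
    ContMDiff 𝓘(ℝ, E) 𝓘(ℝ, E).tangent ∞
      (fun x : M => TotalSpace.mk' E x (Ω.hamiltonianVector f x)) := by
  intro x₀
  rw [contMDiffAt_section]
  let A : M → E →L[ℝ] E →L[ℝ] ℝ := fun x =>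
    ContinuousLinearMap.inCoordinates E (fun x : M => TangentSpace 𝓘(ℝ, E) x) (E →L[ℝ] ℝ)
      (fun x : M => TangentSpace 𝓘(ℝ, E) x →L[ℝ] ℝ) x₀ x x₀ x (Ω.toFun x)
  let D : M → E →L[ℝ] ℝ :=
    inTangentCoordinates 𝓘(ℝ, E) 𝓘(ℝ, ℝ) id f (mfderiv 𝓘(ℝ, E) 𝓘(ℝ, ℝ) f) x₀
  have hA : ContMDiffAt 𝓘(ℝ, E) 𝓘(ℝ, E →L[ℝ] E →L[ℝ] ℝ) ∞ A x₀ :=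
    ((contMDiffAt_hom_bundle _).1 (Ω.smooth x₀)).2
  have hD : ContMDiffAt 𝓘(ℝ, E) 𝓘(ℝ, E →L[ℝ] ℝ) ∞ D x₀ :=
    ContMDiffAt.mfderiv_const (f.contMDiff x₀) (by simp)
  let e := trivializationAt E (fun x : M => TangentSpace 𝓘(ℝ, E) x) x₀
  have hAapp : ∀ x ∈ e.baseSet, ∀ v w : E,
      A x v w = Ω.toFun x (e.symm x v) (e.symm x w) := by
    intro x hx v w
    have h := inCoordinates_apply_eq₂ (𝕜 := ℝ)
      (E₃ := Bundle.Trivial M ℝ) (F₃ := ℝ) (x₀ := x₀) (ϕ := Ω.toFun x) (v := v) (w := w)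
      hx hx (Set.mem_univ _)
    simpa using h
  have hDapp : ∀ x ∈ e.baseSet, ∀ w : E,
      D x w = differential f x (e.symm x w) := by
    intro x hx w
    have h := ContinuousLinearMap.inCoordinates_eq (σ := RingHom.id ℝ)
      (ϕ := mfderiv 𝓘(ℝ, E) 𝓘(ℝ, ℝ) f x) (x₀ := x₀) (y₀ := f x₀) (x := x) (y := f x)
      (F := E) (F' := ℝ) (E := fun x : M => TangentSpace 𝓘(ℝ, E) x)
      (E' := fun x : ℝ => TangentSpace 𝓘(ℝ, ℝ) x)
      hx (by rw [TangentBundle.trivializationAt_baseSet, chartAt_self_eq]; trivial)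
    have h' := congrArg (fun l : E →L[ℝ] ℝ => l w) h
    simp at h'
    exact h'
  have hinv : ∀ x ∈ e.baseSet, (A x).IsInvertible := by
    intro x hx
    apply isInvertible_of_nondegenerate
    intro v hv
    have h0 : (e.symm x v : TangentSpace 𝓘(ℝ, E) x) = 0 := by
      refine Ω.nondegenerate x _ fun w => ?_
      have := hv (e ⟨x, w⟩).2
      rwa [hAapp x hx, e.symm_apply_apply_mk hx] at this
    have h1 := e.apply_mk_symm hx v
    rw [h0] at h1
    have h2 := e.zeroSection ℝ hx
    simpa [zeroSection] using (h1.symm.trans h2)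
  have key : ∀ x ∈ e.baseSet,
      (e ⟨x, Ω.hamiltonianVector f x⟩).2 = -(A x).inverse (D x) := by
    intro x hx
    obtain ⟨a, ha⟩ := hinv x hx
    rw [← ha, ContinuousLinearMap.inverse_equiv, ContinuousLinearEquiv.coe_coe, ← map_neg,
      ContinuousLinearEquiv.eq_symm_apply]
    ext w
    have h := hAapp x hx (e ⟨x, Ω.hamiltonianVector f x⟩).2 w
    rw [e.symm_apply_apply_mk hx, Ω.apply_hamiltonianVector, ← hDapp x hx, ← ha] at h
    exact h
  have hsmooth : ContMDiffAt 𝓘(ℝ, E) 𝓘(ℝ, E) ∞ (fun x => -(A x).inverse (D x)) x₀ := by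
    have h1 : ContMDiffAt 𝓘(ℝ, E) 𝓘(ℝ, (E →L[ℝ] ℝ) →L[ℝ] E) ∞
        (fun x => (A x).inverse) x₀ :=
      ContMDiffAt.comp (g := ContinuousLinearMap.inverse) x₀
        (ContinuousLinearMap.IsInvertible.contDiffAt_map_inverse
          (hinv x₀ (FiberBundle.mem_baseSet_trivializationAt' x₀))).contMDiffAt hA
    exact (h1.clm_apply hD).neg
  refine hsmooth.congr_of_eventuallyEq ?_
  filter_upwards [e.open_baseSet.mem_nhds (FiberBundle.mem_baseSet_trivializationAt' x₀)] with x hx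
  exact key x hx

/-- The Hamiltonian vector field `v_f` of a function `f`, with `df = -ι_{v_f} Ω`. -/
def SymplecticForm.hamiltonianVectorField (Ω : SymplecticForm E M) (f : SmoothFunction E M) :
    SmoothVectorField E M :=
  ⟨Ω.hamiltonianVector f, Ω.contMDiff_hamiltonianVector f⟩

end Poisson

section Action
variable {E : Type*} [NormedAddCommGroup E] [NormedSpace ℝ E]
  {M : Type*} [TopologicalSpace M] [ChartedSpace E M] [IsManifold 𝓘(ℝ, E) ∞ M]
  {EG : Type*} [NormedAddCommGroup EG] [NormedSpace ℝ EG]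
  {G : Type*} [TopologicalSpace G] [ChartedSpace EG G] [Group G]
  [MulAction G M]

variable (E) in
/-- The value `-D(g ↦ g • x)(ξ)` at `x` of the fundamental vector field of `ξ`, the velocity at
`t = 0` of `exp (-t ξ) • x`. -/
def fundamentalVector (ξ : GroupLieAlgebra 𝓘(ℝ, EG) G) (x : M) : TangentSpace 𝓘(ℝ, E) x :=
  -(mfderiv 𝓘(ℝ, EG) 𝓘(ℝ, E) (fun g : G => g • x) 1 ξ : E)

theorem contMDiff_fundamentalVector [IsManifold 𝓘(ℝ, EG) ∞ G]
    [ContMDiffSMul 𝓘(ℝ, EG) 𝓘(ℝ, E) ∞ G M] (ξ : GroupLieAlgebra 𝓘(ℝ, EG) G) :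
    ContMDiff 𝓘(ℝ, E) 𝓘(ℝ, E).tangent ∞
      (fun x : M => TotalSpace.mk' E x (fundamentalVector E ξ x)) := by
  let f₀ : M → TangentBundle 𝓘(ℝ, E) M := fun x => TotalSpace.mk' E x 0
  have s₀ : ContMDiff 𝓘(ℝ, E) 𝓘(ℝ, E).tangent ∞ f₀ := contMDiff_zeroSection _ _
  let f₁ : M → TangentBundle 𝓘(ℝ, EG) G := fun _ => (⟨1, -ξ⟩ : TangentBundle 𝓘(ℝ, EG) G)
  have s₁ : ContMDiff 𝓘(ℝ, E) 𝓘(ℝ, EG).tangent ∞ f₁ := contMDiff_const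
  have s₂ : ContMDiff (𝓘(ℝ, EG).tangent.prod 𝓘(ℝ, E).tangent) (𝓘(ℝ, EG).prod 𝓘(ℝ, E)).tangent ∞
      (equivTangentBundleProd 𝓘(ℝ, EG) G 𝓘(ℝ, E) M).symm := contMDiff_equivTangentBundleProd_symm
  have hs : ContMDiff (𝓘(ℝ, EG).prod 𝓘(ℝ, E)) 𝓘(ℝ, E) ∞ (fun p : G × M => p.1 • p.2) :=
    contMDiff_smul
  have s₃ := hs.contMDiff_tangentMap (m := ∞) (by simp)
  have S := (s₃.comp s₂).comp (s₁.prodMk s₀)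
  have hmk : ∀ (y x : M) (v : E), y = x →
      (TotalSpace.mk' E y (v : TangentSpace 𝓘(ℝ, E) y) : TangentBundle 𝓘(ℝ, E) M)
        = TotalSpace.mk' E x (v : TangentSpace 𝓘(ℝ, E) x) := by
    rintro y x v rfl; rfl
  refine S.congr fun x => ?_
  refine (hmk _ _ _ (one_smul G x)).symm.trans ?_
  simp only [Function.comp_apply, tangentMap, f₀, f₁]
  refine congrArg (fun v : E => (⟨(1 : G) • x, v⟩ : TangentBundle 𝓘(ℝ, E) M)) ?_
  have h := mfderiv_prod_eq_add_apply (I := 𝓘(ℝ, EG)) (I' := 𝓘(ℝ, E)) (I'' := 𝓘(ℝ, E))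
    (f := fun p : G × M => p.1 • p.2) (p := (1, x)) (v := (-ξ, (0 : E)))
    (hs.mdifferentiable (by simp) _)
  refine Eq.trans ?_ h.symm
  have h0 : (mfderiv 𝓘(ℝ, E) 𝓘(ℝ, E) (fun z : M => (1 : G) • z) x) 0 = 0 := map_zero _
  have h1 : (mfderiv 𝓘(ℝ, EG) 𝓘(ℝ, E) (fun g : G => g • x) 1) (-ξ)
      = -(mfderiv 𝓘(ℝ, EG) 𝓘(ℝ, E) (fun g : G => g • x) 1) ξ := map_neg _ _
  exact ((congrArg₂ (fun a b : E => a + b) h1 h0).trans (add_zero _)).symm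

/-- The fundamental vector field `ξ_M` of `ξ ∈ 𝔤`, with `ξ_M(x) = d/dt (exp (-t ξ) • x)` at
`t = 0`. -/
def fundamentalVectorField [IsManifold 𝓘(ℝ, EG) ∞ G]
    [ContMDiffSMul 𝓘(ℝ, EG) 𝓘(ℝ, E) ∞ G M] (ξ : GroupLieAlgebra 𝓘(ℝ, EG) G) :
    SmoothVectorField E M :=
  ⟨fundamentalVector E ξ, contMDiff_fundamentalVector ξ⟩

/-- The adjoint representation: `Ad g` is the derivative at `1` of `h ↦ g h g⁻¹`. -/
def Ad (g : G) : GroupLieAlgebra 𝓘(ℝ, EG) G →L[ℝ] GroupLieAlgebra 𝓘(ℝ, EG) G :=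
  (mfderiv 𝓘(ℝ, EG) 𝓘(ℝ, EG) (fun h : G => g * h * g⁻¹) 1 : EG →L[ℝ] EG)

variable (G) in
/-- The action preserves the form: `g^* Ω = Ω` for every `g`. -/
def IsSymplecticAction [FiniteDimensional ℝ E] (Ω : SymplecticForm E M) : Prop :=
  ∀ (g : G) (x : M) (v w : TangentSpace 𝓘(ℝ, E) x),
    Ω.toFun (g • x) (mfderiv 𝓘(ℝ, E) 𝓘(ℝ, E) (fun y : M => g • y) x v)
      (mfderiv 𝓘(ℝ, E) 𝓘(ℝ, E) (fun y : M => g • y) x w) = Ω.toFun x v w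

variable (E M EG) in
/-- Smooth maps `M → 𝔤^*`, where the Lie algebra `𝔤 = T_1 G` is modelled on `EG`. -/
abbrev DualValuedMap : Type _ := C^∞⟮𝓘(ℝ, E), M; 𝓘(ℝ, EG →L[ℝ] ℝ), EG →L[ℝ] ℝ⟯

/-- The function `μ_ξ = ⟨μ, ξ⟩`. -/
def component (μ : DualValuedMap E M EG) (ξ : GroupLieAlgebra 𝓘(ℝ, EG) G) :
    SmoothFunction E M :=
  ⟨fun x => μ x ξ, μ.contMDiff.clm_apply contMDiff_const⟩

variable (G) in
/-- A moment map: `dμ_ξ = -ι_ξ Ω` for every `ξ`, and `μ` is equivariant for the coadjoint action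
`⟨g • l, ξ⟩ = ⟨l, Ad g⁻¹ ξ⟩` on `𝔤^*`. -/
structure IsMomentMap [FiniteDimensional ℝ E] (Ω : SymplecticForm E M)
    (μ : DualValuedMap E M EG) : Prop where
  differential_eq (ξ : GroupLieAlgebra 𝓘(ℝ, EG) G) (x : M) (w : TangentSpace 𝓘(ℝ, E) x) :
    differential (component μ ξ) x w = -Ω.toFun x (fundamentalVector E ξ x) w
  equivariant (g : G) (x : M) (ξ : GroupLieAlgebra 𝓘(ℝ, EG) G) :
    μ (g • x) ξ = μ x (Ad g⁻¹ ξ)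

/-- The momentum ideal `I_μ`, the ideal of `C^∞(M)` generated by the functions `μ_ξ`. -/
def momentumIdeal (G : Type*) [TopologicalSpace G] [ChartedSpace EG G] [Group G]
    (μ : DualValuedMap E M EG) : Ideal (SmoothFunction E M) :=
  Ideal.span (Set.range fun ξ : GroupLieAlgebra 𝓘(ℝ, EG) G => component μ ξ)

end Action

section Reduction

variable {E : Type*} [NormedAddCommGroup E] [NormedSpace ℝ E]
  {M : Type*} [TopologicalSpace M] [ChartedSpace E M]

/-- The constraints ideal `I_N` of functions vanishing on `N`. -/
def constraintIdeal (E : Type*) [NormedAddCommGroup E] [NormedSpace ℝ E]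
    {M : Type*} [TopologicalSpace M] [ChartedSpace E M] (N : Set M) :
    Ideal (SmoothFunction E M) where
  carrier := {f | ∀ x ∈ N, f x = 0}
  add_mem' hf hg x hx := by simp [hf x hx, hg x hx]
  zero_mem' x _ := rfl
  smul_mem' c f hf x hx := by simp [hf x hx]

variable [IsManifold 𝓘(ℝ, E) ∞ M]

/-- The vector fields tangent to `N`: `u I_N ⊆ I_N`. -/
def tangentFields (N : Set M) : Set (SmoothVectorField E M) :=
  {u | ∀ f ∈ constraintIdeal E N, derivation u f ∈ constraintIdeal E N}

/-- The vector fields vanishing along `N`: `u C^∞(M) ⊆ I_N`. -/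
def vanishingFields (N : Set M) : Set (SmoothVectorField E M) :=
  {u | ∀ f : SmoothFunction E M, derivation u f ∈ constraintIdeal E N}

section LieAlgebraAction

/- `ρ` is the assignment of fundamental vector fields of a Lie algebra action of `𝔤` on `M`. -/
variable {𝔤 : Type*} (ρ : 𝔤 → SmoothVectorField E M) (N : Set M)

/-- The `C^∞(M)`-submodule generated by the fundamental vector fields. -/
def fundamentalModule : Set (SmoothVectorField E M) :=
  {w | ∃ (n : ℕ) (g : Fin n → SmoothFunction E M) (ξ : Fin n → 𝔤),
    w = ∑ i, fsmul (g i) (ρ (ξ i))}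

variable [FiniteDimensional ℝ E]

/-- The reducible vector fields: `v` is tangent to `N`, and each `[v, ξ_M]` lies in the
fundamental module plus the vector fields vanishing along `N`. -/
def reducibleFields : Set (SmoothVectorField E M) :=
  {v | v ∈ tangentFields N ∧
    ∀ ξ, lieBracket v (ρ ξ) ∈ fundamentalModule ρ + vanishingFields N}

/-- The reducible forms of degree `0`: `L_ξ f` vanishes along `N` for all `ξ ∈ 𝔤`. In degree `0`
the vanishing de Rham ideal is `I_N`, and the other condition, on `ι_ξ f = 0`, is void. -/
def reducibleZeroForms : Set (SmoothFunction E M) :=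
  {f | ∀ ξ, derivation (ρ ξ) f ∈ constraintIdeal E N}

/-- The observables of a `1`-plectic manifold, all of degree `0`: pairs `(v, f)` with
`df = -ι_v Ω`. -/
def observables (Ω : SymplecticForm E M) : Set (SmoothVectorField E M × SmoothFunction E M) :=
  {p | ∀ (x : M) (w : TangentSpace 𝓘(ℝ, E) x), differential p.2 x w = -Ω.toFun x (p.1 x) w}

/-- The reducible observables: `v` and `f` are both reducible. -/
def reducibleObservables (Ω : SymplecticForm E M) :
    Set (SmoothVectorField E M × SmoothFunction E M) :=
  {p | p ∈ observables Ω ∧ p.1 ∈ reducibleFields ρ N ∧ p.2 ∈ reducibleZeroForms ρ N}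

/-- The vanishing observables: reducible observables `(v, f)` such that `v` lies in the fundamental
module plus the vector fields vanishing along `N`, and `f` vanishes along `N`. -/
def vanishingObservables (Ω : SymplecticForm E M) :
    Set (SmoothVectorField E M × SmoothFunction E M) :=
  {p | p ∈ reducibleObservables ρ N Ω ∧ p.1 ∈ fundamentalModule ρ + vanishingFields N ∧
    p.2 ∈ constraintIdeal E N}

/-- `L_∞(M, Ω)_{[N]}`: the image of the reducible observables under `(v, f) ↦ f`. -/
def LInftyReducible (Ω : SymplecticForm E M) : Set (SmoothFunction E M) :=
  Prod.snd '' reducibleObservables ρ N Ω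

/-- `I_{L_∞}(N)`: the image of the vanishing observables under `(v, f) ↦ f`. -/
def LInftyVanishing (Ω : SymplecticForm E M) : Set (SmoothFunction E M) :=
  Prod.snd '' vanishingObservables ρ N Ω

end LieAlgebraAction

section Poisson

variable [FiniteDimensional ℝ E]

/-- The Poisson bracket `{f, h} = Ω(v_f, v_h)`. -/
def poissonBracket (Ω : SymplecticForm E M) (f h : SmoothFunction E M) : SmoothFunction E M :=
  Ω.pair (Ω.hamiltonianVectorField f) (Ω.hamiltonianVectorField h)

/-- The set `F_N` of first class functions: `{f, I_N} ⊆ I_N`. -/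
def firstClass (Ω : SymplecticForm E M) (N : Set M) : Set (SmoothFunction E M) :=
  {f | ∀ h ∈ constraintIdeal E N, poissonBracket Ω f h ∈ constraintIdeal E N}

/-- The set `Q` of Casimir functions along `N`: `{f, C^∞(M)} ⊆ I_N`. -/
def casimirs (Ω : SymplecticForm E M) (N : Set M) : Set (SmoothFunction E M) :=
  {f | ∀ h : SmoothFunction E M, poissonBracket Ω f h ∈ constraintIdeal E N}

/-- The set `Q'` of functions `f` with `{f, μ_ξ} ∈ I_μ + Q` for all `ξ ∈ 𝔤`. -/
def casimirs' {EG : Type*} [NormedAddCommGroup EG] [NormedSpace ℝ EG]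
    (G : Type*) [TopologicalSpace G] [ChartedSpace EG G] [Group G]
    (Ω : SymplecticForm E M) (μ : DualValuedMap E M EG) (N : Set M) :
    Set (SmoothFunction E M) :=
  {f | ∀ ξ : GroupLieAlgebra 𝓘(ℝ, EG) G, poissonBracket Ω f (component μ ξ) ∈
    (momentumIdeal G μ : Set (SmoothFunction E M)) + casimirs Ω N}

end Poisson

/-- The structure of a Poisson algebra on a commutative algebra. -/
structure PoissonStructure (R A : Type*) [CommRing R] [CommRing A] [Algebra R A] where
  /-- the Poisson bracket -/
  bracket : A →ₗ[R] A →ₗ[R] A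
  self (a : A) : bracket a a = 0
  jacobi (a b c : A) :
    bracket a (bracket b c) = bracket (bracket a b) c + bracket b (bracket a c)
  leibniz (a b c : A) : bracket a (b * c) = bracket a b * c + b * bracket a c

end Reduction

end SymplecticReduction
end

/-! The whole statement is translated from vector fields into Poisson brackets. By nondegeneracy an
observable `(v, f)` has `v = v_f`, and `v_f` acts as `{f, ·}`. The moment map condition says that
the fundamental field of `ξ` is the Hamiltonian field of `μ_ξ`. The Jacobi identity, which comes
from `dΩ = 0`, makes `[v_f, ξ_M]` act as `{{f, μ_ξ}, ·}`.

The central step is `IsMomentMap.mem_fundamentalModule_add_vanishingFields_iff`: `∑ aᵢ {μ_ξᵢ, ·}`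
and `{∑ aᵢ μ_ξᵢ, ·}` differ by `∑ μ_ξᵢ {aᵢ, ·}`, which vanishes along `N`. Taking `g = {f, μ_ξ}`
turns the commutator condition into `Q'`, and `g = f` describes the vanishing observables. The
condition that `ξ_M f` vanish on `N` follows from first-classness, since `μ_ξ ∈ I_N`. The modular
law with `I_μ ⊆ I_N` rewrites `I_N ∩ (I_μ + Q)` as `K = I_μ + (I_N ∩ Q)`.

For the algebra structure, `F_N ∩ Q'` consists of the first class `f` with `{f, μ_ξ} ∈ K`. As `K` is
an ideal of `C^∞(M)`, Leibniz and Jacobi give closure under products and brackets, and stability of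
`K`. Equivariance is used for `K ⊆ F_N ∩ Q'`: it makes `N` invariant, so `μ_ξ` is first class, and
differentiating it shows that `{μ_η, μ_ξ}` is again a component of `μ`. -/

namespace SymplecticReduction

/-! ### The Lie bracket of vector fields as a commutator of derivations. -/

section LieDerivative

variable {E : Type*} [NormedAddCommGroup E] [NormedSpace ℝ E] [FiniteDimensional ℝ E]
  {M : Type*} [TopologicalSpace M] [ChartedSpace E M] [IsManifold 𝓘(ℝ, E) ∞ M]

/-- The local representative of a vector field in the chart at `x₀`. -/
noncomputable def chartField (x₀ : M) (v : SmoothVectorField E M) : E → E :=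
  mpullbackWithin 𝓘(ℝ, E) 𝓘(ℝ, E) (extChartAt 𝓘(ℝ, E) x₀).symm v (Set.range 𝓘(ℝ, E))

theorem differentiableAt_chartField (x₀ : M) (v : SmoothVectorField E M) :
    DifferentiableAt ℝ (chartField x₀ v) (extChartAt 𝓘(ℝ, E) x₀ x₀) := by
  have := FiniteDimensional.complete ℝ E
  have : IsManifold 𝓘(ℝ, E) 2 M := IsManifold.of_le (n := ∞) (by simpa using ENat.LEInfty.out)
  have h : DifferentiableWithinAt ℝ (chartField x₀ v) ((extChartAt 𝓘(ℝ, E) x₀).symm ⁻¹' Set.univ ∩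
      Set.range 𝓘(ℝ, E)) (extChartAt 𝓘(ℝ, E) x₀ x₀) :=
    MDifferentiableWithinAt.differentiableWithinAt_mpullbackWithin_vectorField
    (I := 𝓘(ℝ, E)) (s := Set.univ) (x := x₀) (V := v)
    ((v.contMDiff x₀).mdifferentiableAt (by simp)).mdifferentiableWithinAt
  rwa [Set.preimage_univ, modelWithCornersSelf_coe, Set.range_id, Set.univ_inter,
    differentiableWithinAt_univ] at h

-- The pullback applies the inverse of the differential of the inverse chart, which cancels against
-- that differential in the chain rule.
omit [FiniteDimensional ℝ E] in
theorem fderiv_comp_symm_chartField (x₀ : M) (v : SmoothVectorField E M) (f : SmoothFunction E M)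
    {y : E} (hy : y ∈ (extChartAt 𝓘(ℝ, E) x₀).target) :
    fderiv ℝ (f ∘ (extChartAt 𝓘(ℝ, E) x₀).symm) y (chartField x₀ v y) =
      derivation v f ((extChartAt 𝓘(ℝ, E) x₀).symm y) := by
  have : IsManifold 𝓘(ℝ, E) 1 M := IsManifold.of_le (n := ∞) (by simp)
  have h1 := isInvertible_mfderivWithin_extChartAt_symm (I := 𝓘(ℝ, E)) hy
  have hs : MDifferentiableAt 𝓘(ℝ, E) 𝓘(ℝ, E) (extChartAt 𝓘(ℝ, E) x₀).symm y := by
    have := mdifferentiableWithinAt_extChartAt_symm (I := 𝓘(ℝ, E)) hy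
    rwa [modelWithCornersSelf_coe, Set.range_id, mdifferentiableWithinAt_univ] at this
  have hc := mfderiv_comp y ((f.contMDiff _).mdifferentiableAt (by simp)) hs
  rw [← mfderiv_eq_fderiv, hc]
  simp only [chartField, mpullbackWithin_apply]
  simp only [modelWithCornersSelf_coe, Set.range_id, mfderivWithin_univ] at h1 ⊢
  obtain ⟨e, he⟩ := h1
  rw [← he, ContinuousLinearMap.inverse_equiv]
  change mfderiv _ _ f _ (e (e.symm _)) = _
  rw [e.apply_symm_apply]
  rfl

/-- The identity holds in a normed space for a sufficiently smooth function; it is applied to `f ∘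
φ⁻¹` and the local representatives in the chart `φ` at the point, then transported back by the chain
rule. -/
theorem derivation_lieBracket (v w : SmoothVectorField E M) (f : SmoothFunction E M) :
    derivation (lieBracket v w) f =
      derivation v (derivation w f) - derivation w (derivation v f) := by
  ext x₀
  have : IsManifold 𝓘(ℝ, E) 1 M := IsManifold.of_le (n := ∞) (by simp)
  set φ := extChartAt 𝓘(ℝ, E) x₀
  have hx : φ x₀ ∈ φ.target := mem_extChartAt_target x₀
  have hsx : φ.symm (φ x₀) = x₀ := extChartAt_to_inv x₀
  have hF : ContDiffAt ℝ ∞ (f ∘ φ.symm) (φ x₀) := by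
    have h1 := contMDiffWithinAt_extChartAt_symm_range_self (I := 𝓘(ℝ, E)) (n := ∞) x₀
    simp only [modelWithCornersSelf_coe, Set.range_id, contMDiffWithinAt_univ] at h1
    exact ((f.contMDiff _).comp _ h1).contDiffAt
  have hnhds : φ.target ∈ 𝓝 (φ x₀) := extChartAt_target_mem_nhds x₀
  have key : ∀ u : SmoothVectorField E M,
      (fun y => fderiv ℝ (f ∘ φ.symm) y (chartField x₀ u y)) =ᶠ[𝓝 (φ x₀)]
        derivation u f ∘ φ.symm := by
    intro u
    filter_upwards [hnhds] with y hy
    exact fderiv_comp_symm_chartField x₀ u f hy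
  have h := fderiv_apply_lieBracket (𝕜 := ℝ) hF (by simpa using ENat.LEInfty.out)
    (differentiableAt_chartField x₀ w) (differentiableAt_chartField x₀ v)
  rw [(key w).fderiv_eq, (key v).fderiv_eq, fderiv_comp_symm_chartField x₀ _ _ hx,
    fderiv_comp_symm_chartField x₀ _ _ hx, hsx] at h
  refine Eq.trans ?_ h
  have hc := mfderiv_comp x₀ (I' := 𝓘(ℝ, E)) (g := f ∘ φ.symm) (f := φ)
    ((hF.differentiableAt (by simp)).mdifferentiableAt)
    (mdifferentiableAt_extChartAt (mem_chart_source E x₀))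
  have heq : (f ∘ φ.symm) ∘ φ =ᶠ[𝓝 x₀] f := by
    filter_upwards [extChartAt_source_mem_nhds (I := 𝓘(ℝ, E)) x₀] with z hz
    exact congrArg f (φ.left_inv hz)
  rw [heq.mfderiv_eq] at hc
  let A : E →L[ℝ] E := mfderiv 𝓘(ℝ, E) 𝓘(ℝ, E) φ x₀
  have hA : A.IsInvertible :=
    isInvertible_mfderiv_extChartAt (I := 𝓘(ℝ, E)) (mem_extChartAt_source x₀)
  obtain ⟨e, he⟩ := hA
  -- The set is the one in the definition of the manifold bracket, so that `h3` below is
  -- definitional; the model being boundaryless, it is the whole space.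
  let b : E := lieBracketWithin ℝ (chartField x₀ v) (chartField x₀ w)
    (φ.symm ⁻¹' Set.univ ∩ Set.range 𝓘(ℝ, E)) (φ x₀)
  have hb : b = VectorField.lieBracket ℝ (chartField x₀ v) (chartField x₀ w) (φ x₀) := by
    simp [b]
  have hl : lieBracket v w x₀ = e.symm b := by
    have h3 : lieBracket v w x₀ = A.inverse b := rfl
    rw [h3, ← he, ContinuousLinearMap.inverse_equiv]
    rfl
  change mfderiv _ _ f x₀ (lieBracket v w x₀) = _
  rw [hl, hc, mfderiv_eq_fderiv, ← hb]
  change fderiv ℝ (f ∘ φ.symm) _ (A (e.symm b)) = _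
  rw [← he]
  exact congrArg (fun u => fderiv ℝ (f ∘ φ.symm) (φ x₀) u) (e.apply_symm_apply b)

end LieDerivative

/-! ### Algebra of derivations along vector fields. -/

section Derivation

variable {E : Type*} [NormedAddCommGroup E] [NormedSpace ℝ E]
  {M : Type*} [TopologicalSpace M] [ChartedSpace E M] [IsManifold 𝓘(ℝ, E) ∞ M]

omit [IsManifold 𝓘(ℝ, E) ∞ M] in
theorem mdifferentiableAt_smoothFunction (f : SmoothFunction E M) (x : M) :
    MDifferentiableAt 𝓘(ℝ, E) 𝓘(ℝ, ℝ) f x :=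
  (f.contMDiff x).mdifferentiableAt (by simp)

theorem derivation_add_right (v : SmoothVectorField E M) (f g : SmoothFunction E M) :
    derivation v (f + g) = derivation v f + derivation v g := by
  ext x
  have h := ((mdifferentiableAt_smoothFunction f x).hasMFDerivAt.add
    (mdifferentiableAt_smoothFunction g x).hasMFDerivAt).mfderiv
  exact congrArg (fun l : E →L[ℝ] ℝ => l (v x)) h

theorem derivation_mul (v : SmoothVectorField E M) (f g : SmoothFunction E M) :
    derivation v (f * g) = derivation v f * g + f * derivation v g := by
  ext x
  have h := ((mdifferentiableAt_smoothFunction f x).hasMFDerivAt.mul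
    (mdifferentiableAt_smoothFunction g x).hasMFDerivAt).mfderiv
  refine (congrArg (fun l : E →L[ℝ] ℝ => l (v x)) h).trans ?_
  change f x * differential g x (v x) + g x * differential f x (v x) =
    differential f x (v x) * g x + f x * differential g x (v x)
  ring

theorem derivation_smul (v : SmoothVectorField E M) (c : ℝ) (f : SmoothFunction E M) :
    derivation v (c • f) = c • derivation v f := by
  ext x
  have h := ((mdifferentiableAt_smoothFunction f x).hasMFDerivAt.const_smul c).mfderiv
  exact congrArg (fun l : E →L[ℝ] ℝ => l (v x)) h

/-- The derivative along a vector field, as a linear map. -/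
noncomputable def derivationLinearMap (v : SmoothVectorField E M) :
    SmoothFunction E M →ₗ[ℝ] SmoothFunction E M where
  toFun := derivation v
  map_add' := derivation_add_right v
  map_smul' := derivation_smul v

theorem derivation_neg (v : SmoothVectorField E M) (f : SmoothFunction E M) :
    derivation v (-f) = -derivation v f :=
  map_neg (derivationLinearMap v) f

theorem derivation_add_left (v w : SmoothVectorField E M) (f : SmoothFunction E M) :
    derivation (v + w) f = derivation v f + derivation w f := by
  ext x
  exact map_add (differential f x) (v x) (w x)

theorem derivation_sub_left (v w : SmoothVectorField E M) (f : SmoothFunction E M) :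
    derivation (v - w) f = derivation v f - derivation w f := by
  ext x
  exact map_sub (differential f x) (v x) (w x)

theorem derivation_fsmul (g : SmoothFunction E M) (v : SmoothVectorField E M)
    (f : SmoothFunction E M) : derivation (fsmul g v) f = g * derivation v f := by
  ext x
  exact map_smul (differential f x) (g x) (v x)

theorem derivation_zero_left (f : SmoothFunction E M) :
    derivation (0 : SmoothVectorField E M) f = 0 := by
  ext x
  exact map_zero (differential f x)

theorem derivation_sum_fsmul {ι : Type*} (s : Finset ι) (g : ι → SmoothFunction E M)
    (v : ι → SmoothVectorField E M) (f : SmoothFunction E M) :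
    derivation (∑ i ∈ s, fsmul (g i) (v i)) f = ∑ i ∈ s, g i * derivation (v i) f := by
  classical
  induction s using Finset.induction_on with
  | empty => simp [derivation_zero_left]
  | insert a s ha ih =>
    rw [Finset.sum_insert ha, Finset.sum_insert ha, derivation_add_left, derivation_fsmul, ih]

/-- Membership in the fundamental module plus the vector fields vanishing along `N`, tested on
functions. -/
theorem mem_fundamentalModule_add_vanishingFields {𝔤 : Type*} (ρ : 𝔤 → SmoothVectorField E M)
    (N : Set M) (v : SmoothVectorField E M) :
    v ∈ fundamentalModule ρ + vanishingFields N ↔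
      ∃ (n : ℕ) (g : Fin n → SmoothFunction E M) (ξ : Fin n → 𝔤), ∀ f : SmoothFunction E M,
        derivation v f - ∑ i, g i * derivation (ρ (ξ i)) f ∈ constraintIdeal E N := by
  rw [Set.mem_add]
  constructor
  · rintro ⟨_, ⟨n, g, ξ, rfl⟩, u, hu, rfl⟩
    refine ⟨n, g, ξ, fun f => ?_⟩
    rw [derivation_add_left, derivation_sum_fsmul, add_sub_cancel_left]
    exact hu f
  · rintro ⟨n, g, ξ, h⟩
    -- The remainder itself is the witness, so no vector field has to be recovered from its action
    -- on functions.
    refine ⟨_, ⟨n, g, ξ, rfl⟩, v - ∑ i, fsmul (g i) (ρ (ξ i)), fun f => ?_, by abel⟩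
    rw [derivation_sub_left, derivation_sum_fsmul]
    exact h f

end Derivation

/-! ### The Poisson bracket of a symplectic manifold. -/

section Poisson

variable {E : Type*} [NormedAddCommGroup E] [NormedSpace ℝ E] [FiniteDimensional ℝ E]
  {M : Type*} [TopologicalSpace M] [ChartedSpace E M] [IsManifold 𝓘(ℝ, E) ∞ M]

omit [FiniteDimensional ℝ E] in
theorem TwoForm.skew (Ω : TwoForm E M) (x : M) (v w : TangentSpace 𝓘(ℝ, E) x) :
    Ω.toFun x v w = -Ω.toFun x w v := by
  have h := Ω.alternating x (v + w)
  simp only [map_add, add_apply, Ω.alternating] at h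
  linarith

variable (Ω : SymplecticForm E M)

theorem SymplecticForm.pair_hamiltonianVectorField_left (f : SmoothFunction E M)
    (w : SmoothVectorField E M) :
    Ω.pair (Ω.hamiltonianVectorField f) w = -derivation w f := by
  ext x
  exact Ω.apply_hamiltonianVector f x (w x)

theorem SymplecticForm.pair_hamiltonianVectorField_right (f : SmoothFunction E M)
    (w : SmoothVectorField E M) :
    Ω.pair w (Ω.hamiltonianVectorField f) = derivation w f := by
  ext x
  have h := Ω.skew x (w x) (Ω.hamiltonianVector f x)
  rw [Ω.apply_hamiltonianVector f x (w x), neg_neg] at h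
  exact h

theorem poissonBracket_eq_derivation (f h : SmoothFunction E M) :
    poissonBracket Ω f h = derivation (Ω.hamiltonianVectorField f) h :=
  Ω.pair_hamiltonianVectorField_right h _

theorem poissonBracket_skew (f h : SmoothFunction E M) :
    poissonBracket Ω f h = -poissonBracket Ω h f := by
  rw [poissonBracket_eq_derivation Ω h f]
  exact Ω.pair_hamiltonianVectorField_left f _

theorem poissonBracket_mul (f g h : SmoothFunction E M) :
    poissonBracket Ω f (g * h) = poissonBracket Ω f g * h + g * poissonBracket Ω f h := by
  simp only [poissonBracket_eq_derivation, derivation_mul]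

theorem poissonBracket_neg (f h : SmoothFunction E M) :
    poissonBracket Ω f (-h) = -poissonBracket Ω f h := by
  simp only [poissonBracket_eq_derivation, derivation_neg]

theorem poissonBracket_add (f g h : SmoothFunction E M) :
    poissonBracket Ω f (g + h) = poissonBracket Ω f g + poissonBracket Ω f h := by
  simp only [poissonBracket_eq_derivation, derivation_add_right]

theorem poissonBracket_smul (c : ℝ) (f h : SmoothFunction E M) :
    poissonBracket Ω f (c • h) = c • poissonBracket Ω f h := by
  simp only [poissonBracket_eq_derivation, derivation_smul]

theorem poissonBracket_self (f : SmoothFunction E M) : poissonBracket Ω f f = 0 := by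
  ext x
  exact Ω.alternating x _

/-- The Poisson bracket as a bilinear map. -/
noncomputable def poissonBilinear :
    SmoothFunction E M →ₗ[ℝ] SmoothFunction E M →ₗ[ℝ] SmoothFunction E M :=
  LinearMap.mk₂ ℝ (poissonBracket Ω)
    (fun f g h => by
      rw [poissonBracket_skew, poissonBracket_add, neg_add, ← poissonBracket_skew,
        ← poissonBracket_skew])
    (fun c f h => by
      rw [poissonBracket_skew, poissonBracket_smul, ← smul_neg, ← poissonBracket_skew])
    (poissonBracket_add Ω) (fun c f h => poissonBracket_smul Ω c f h)

theorem mul_poissonBracket (f g h : SmoothFunction E M) :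
    poissonBracket Ω (f * g) h = f * poissonBracket Ω g h + g * poissonBracket Ω f h := by
  rw [poissonBracket_skew, poissonBracket_mul, poissonBracket_skew Ω h f,
    poissonBracket_skew Ω h g]
  ring

theorem derivation_lieBracket_hamiltonianVectorField (f h k : SmoothFunction E M) :
    derivation (lieBracket (Ω.hamiltonianVectorField f) (Ω.hamiltonianVectorField h)) k =
      poissonBracket Ω f (poissonBracket Ω h k) - poissonBracket Ω h (poissonBracket Ω f k) := by
  simp only [derivation_lieBracket, poissonBracket_eq_derivation]

theorem poissonBracket_jacobi (f h k : SmoothFunction E M) :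
    poissonBracket Ω f (poissonBracket Ω h k) =
      poissonBracket Ω (poissonBracket Ω f h) k + poissonBracket Ω h (poissonBracket Ω f k) := by
  have hc := Ω.closed (Ω.hamiltonianVectorField f) (Ω.hamiltonianVectorField h)
    (Ω.hamiltonianVectorField k)
  simp only [Ω.pair_hamiltonianVectorField_right, derivation_lieBracket,
    ← poissonBracket_eq_derivation] at hc
  rw [poissonBracket_skew Ω k h, poissonBracket_skew Ω k f, poissonBracket_skew Ω h f,
    poissonBracket_neg, poissonBracket_neg, poissonBracket_neg] at hc
  rw [poissonBracket_skew Ω (poissonBracket Ω f h) k]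
  -- Once the commutators are expanded, each of the three double brackets occurs three times in
  -- `dΩ(v_f, v_h, v_k)`; two occurrences cancel, leaving the negative of the Jacobi identity.
  linear_combination -hc

/-- Nondegeneracy of the form; this lets a pair `(v, f)` be replaced by `f` alone. -/
theorem hamiltonianVectorField_unique {f : SmoothFunction E M} {v : SmoothVectorField E M}
    (h : (v, f) ∈ observables Ω) : v = Ω.hamiltonianVectorField f := by
  ext x
  refine sub_eq_zero.1 (Ω.nondegenerate x (v x - Ω.hamiltonianVector f x) fun w => ?_)
  have h1 : differential f x w = -Ω.toFun x (v x) w := h x w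
  have h2 := Ω.apply_hamiltonianVector f x w
  rw [map_sub, sub_apply, h2, h1]
  ring

theorem hamiltonianVectorField_mem_observables (f : SmoothFunction E M) :
    (Ω.hamiltonianVectorField f, f) ∈ observables Ω := fun x w => by
  have h := Ω.apply_hamiltonianVector f x w
  change differential f x w = -Ω.toFun x (Ω.hamiltonianVector f x) w
  rw [h, neg_neg]

end Poisson

/-! ### Differentiability of the adjoint action at the identity. -/

section Adjoint

variable {EG : Type*} [NormedAddCommGroup EG] [NormedSpace ℝ EG]
  {G : Type*} [TopologicalSpace G] [ChartedSpace EG G] [Group G] [LieGroup 𝓘(ℝ, EG) ∞ G]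

variable (G) in
/-- The orbit map `g ↦ Ad g⁻¹ ξ` with values in the model space of `𝔤`. -/
noncomputable def adInvOrbit (ξ : EG) (g : G) : EG :=
  Ad (EG := EG) g⁻¹ ξ

/-- `Ad g⁻¹` is the partial derivative at `h = 1` of the jointly smooth map `(g, h) ↦ g⁻¹ h g`,
hence smooth in `g` when read in tangent coordinates. Every conjugation fixes `1`, so these
coordinates do not vary with `g` and can be undone by the constant maps `C` and `D`. -/
theorem mdifferentiableAt_adInvOrbit (ξ : EG) :
    MDifferentiableAt 𝓘(ℝ, EG) 𝓘(ℝ, EG) (adInvOrbit G ξ) 1 := by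
  have : IsManifold 𝓘(ℝ, EG) 1 G := IsManifold.of_le (n := ∞) (by simp)
  let c : G → G → G := fun g h => g⁻¹ * h * (g⁻¹)⁻¹
  have hc1 : ∀ g : G, c g 1 = 1 := fun g => by simp [c]
  have hc : ContMDiff (𝓘(ℝ, EG).prod 𝓘(ℝ, EG)) 𝓘(ℝ, EG) ∞ (Function.uncurry c) :=
    ((contMDiff_fst.inv).mul contMDiff_snd).mul contMDiff_fst.inv.inv
  have h := ContMDiffAt.mfderiv (m := ∞) (x₀ := (1 : G)) c (fun _ => (1 : G)) (hc _)
    contMDiffAt_const (by simp)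
  let B : G → EG →L[ℝ] EG := inTangentCoordinates 𝓘(ℝ, EG) 𝓘(ℝ, EG) (fun _ => (1 : G))
    (fun g => c g 1) (fun g => mfderiv 𝓘(ℝ, EG) 𝓘(ℝ, EG) (c g) 1) 1
  have hB : MDifferentiableAt 𝓘(ℝ, EG) 𝓘(ℝ, EG →L[ℝ] EG) B 1 := h.mdifferentiableAt (by simp)
  let C : EG →L[ℝ] EG := mfderiv 𝓘(ℝ, EG) 𝓘(ℝ, EG) (extChartAt 𝓘(ℝ, EG) (1 : G)) 1
  let D : EG →L[ℝ] EG := mfderivWithin 𝓘(ℝ, EG) 𝓘(ℝ, EG) (extChartAt 𝓘(ℝ, EG) (1 : G)).symm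
    (Set.range 𝓘(ℝ, EG)) (extChartAt 𝓘(ℝ, EG) (1 : G) 1)
  have hDC : ∀ v, D (C v) = v := fun v => congrArg (fun l : EG →L[ℝ] EG => l v)
    (mfderivWithin_extChartAt_symm_comp_mfderiv_extChartAt'
      (mem_extChartAt_source (I := 𝓘(ℝ, EG)) (1 : G)))
  have hmove : ∀ a b : G, a = 1 → b = 1 →
      (mfderiv 𝓘(ℝ, EG) 𝓘(ℝ, EG) (extChartAt 𝓘(ℝ, EG) a) b : EG →L[ℝ] EG) = C := by
    rintro _ _ rfl rfl; rfl
  have hBeq : ∀ g v, B g v = C (adInvOrbit G (D v) g) := by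
    intro g v
    have h1 := inTangentCoordinates_eq_mfderiv_comp (I := 𝓘(ℝ, EG)) (I' := 𝓘(ℝ, EG))
      (f := fun _ : G => (1 : G)) (g := fun g => c g 1) (x₀ := (1 : G)) (x := g)
      (ϕ := fun g => mfderiv 𝓘(ℝ, EG) 𝓘(ℝ, EG) (c g) 1)
      (mem_chart_source EG (1 : G)) (by simp only [hc1]; exact mem_chart_source EG (1 : G))
    refine (congrArg (fun l : EG →L[ℝ] EG => l v) h1).trans ?_
    exact congrArg (fun l : EG →L[ℝ] EG => l (adInvOrbit G (D v) g))
      (hmove _ _ (hc1 1) (hc1 g))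
  have hAd : adInvOrbit G ξ = fun g => D (B g (C ξ)) := by
    funext g
    rw [hBeq, hDC, hDC]
  rw [hAd]
  exact D.differentiableAt.mdifferentiableAt.comp (I' := 𝓘(ℝ, EG)) (1 : G)
    (hB.clm_apply mdifferentiableAt_const)

end Adjoint

/-! ### Consequences of the moment map equation and of equivariance. -/

section MomentMap

variable {E : Type*} [NormedAddCommGroup E] [NormedSpace ℝ E] [FiniteDimensional ℝ E]
  {M : Type*} [TopologicalSpace M] [ChartedSpace E M] [IsManifold 𝓘(ℝ, E) ∞ M]
  {EG : Type*} [NormedAddCommGroup EG] [NormedSpace ℝ EG]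
  {G : Type*} [TopologicalSpace G] [ChartedSpace EG G] [Group G] [LieGroup 𝓘(ℝ, EG) ∞ G]
  [MulAction G M] [ContMDiffSMul 𝓘(ℝ, EG) 𝓘(ℝ, E) ∞ G M]

omit [FiniteDimensional ℝ E] in
/-- The derivative along a fundamental vector field is minus the derivative along orbits. -/
theorem derivation_fundamentalVectorField
    (ξ : GroupLieAlgebra 𝓘(ℝ, EG) G) (f : SmoothFunction E M) (x : M) :
    derivation (fundamentalVectorField ξ) f x =
      -(mfderiv 𝓘(ℝ, EG) 𝓘(ℝ, ℝ) (fun g : G => f (g • x)) 1 ξ : ℝ) := by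
  have ho : ContMDiff 𝓘(ℝ, EG) 𝓘(ℝ, E) ∞ (fun g : G => g • x) :=
    contMDiff_id.smul contMDiff_const
  have h := mfderiv_comp (1 : G) (mdifferentiableAt_smoothFunction f ((1 : G) • x))
    ((ho 1).mdifferentiableAt (by simp))
  have h1 := congrArg (fun l : EG →L[ℝ] ℝ => l ξ) h
  -- The chain rule lands at `1 • x`, which equals `x` only propositionally.
  have hmove : ∀ y : M, y = x → ∀ v : E,
      (mfderiv 𝓘(ℝ, E) 𝓘(ℝ, ℝ) f y : E →L[ℝ] ℝ) v = (differential f x : E →L[ℝ] ℝ) v := by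
    rintro _ rfl v; rfl
  have h2 := h1.trans (hmove _ (one_smul G x) _)
  refine Eq.trans ?_ (congrArg Neg.neg h2).symm
  exact map_neg (differential f x : E →L[ℝ] ℝ) _

variable {Ω : SymplecticForm E M} {μ : DualValuedMap E M EG}

theorem IsMomentMap.fundamentalVectorField_eq (hμ : IsMomentMap G Ω μ)
    (ξ : GroupLieAlgebra 𝓘(ℝ, EG) G) :
    (fundamentalVectorField ξ : SmoothVectorField E M) =
      Ω.hamiltonianVectorField (component μ ξ) :=
  hamiltonianVectorField_unique Ω fun x w => hμ.differential_eq ξ x w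

omit [LieGroup 𝓘(ℝ, EG) ∞ G] [ContMDiffSMul 𝓘(ℝ, EG) 𝓘(ℝ, E) ∞ G M] in
theorem IsMomentMap.smul_mem_zeroLocus (hμ : IsMomentMap G Ω μ) (g : G) {x : M}
    (hx : x ∈ μ ⁻¹' {0}) : g • x ∈ μ ⁻¹' {0} := by
  have hx0 : μ x = 0 := hx
  change μ (g • x) = 0
  ext ξ
  exact (hμ.equivariant g x ξ).trans (by rw [hx0]; rfl)

/-- The fundamental vector fields are tangent to the zero locus of the moment map. -/
theorem IsMomentMap.component_mem_firstClass (hμ : IsMomentMap G Ω μ)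
    (ξ : GroupLieAlgebra 𝓘(ℝ, EG) G) : component μ ξ ∈ firstClass Ω (μ ⁻¹' {0}) := by
  intro f hf x hx
  rw [poissonBracket_eq_derivation, ← hμ.fundamentalVectorField_eq,
    derivation_fundamentalVectorField]
  -- The orbit of `x` stays in `N`, where `f` vanishes.
  have h0 : (fun g : G => f (g • x)) = fun _ => 0 :=
    funext fun g => hf _ (hμ.smul_mem_zeroLocus g hx)
  rw [h0, mfderiv_const]
  exact neg_zero

/-- Differentiate `μ_ξ(g • x) = μ(x)(Ad g⁻¹ ξ)` at `g = 1` along `η`. The linear form `μ(x)` passes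
through the derivative, so `ζ` does not depend on `x`; its sign is that of the fundamental fields.
Only its existence matters, so it is not identified with a Lie bracket. -/
theorem IsMomentMap.exists_poissonBracket_component (hμ : IsMomentMap G Ω μ)
    (η ξ : GroupLieAlgebra 𝓘(ℝ, EG) G) : ∃ ζ : GroupLieAlgebra 𝓘(ℝ, EG) G,
    poissonBracket Ω (component μ η) (component μ ξ) = component μ ζ := by
  have hAd := mdifferentiableAt_adInvOrbit (G := G) (EG := EG) ξ
  refine ⟨-(mfderiv 𝓘(ℝ, EG) 𝓘(ℝ, EG) (adInvOrbit (EG := EG) G ξ) 1 η : EG),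
    ?_⟩
  ext x
  rw [poissonBracket_eq_derivation, ← hμ.fundamentalVectorField_eq,
    derivation_fundamentalVectorField]
  have h0 : (fun g : G => component μ ξ (g • x)) =
      μ x ∘ adInvOrbit (EG := EG) G ξ :=
    funext fun g => hμ.equivariant g x ξ
  rw [h0, mfderiv_comp (1 : G) (I' := 𝓘(ℝ, EG)) (μ x).differentiableAt.mdifferentiableAt hAd,
    mfderiv_eq_fderiv, ContinuousLinearMap.fderiv]
  exact (map_neg (μ x) _).symm

end MomentMap

/-! ### Restriction and quotient of abstract Poisson structures. -/

namespace PoissonStructure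

variable {R A : Type*} [CommRing R] [CommRing A] [Algebra R A] (P : PoissonStructure R A)

theorem skew (a b : A) : P.bracket a b = -P.bracket b a := by
  have h := P.self (a + b)
  simp only [map_add, LinearMap.add_apply, P.self, zero_add, add_zero] at h
  exact eq_neg_of_add_eq_zero_right h

/-- The restriction of a Poisson structure to a subalgebra closed under the bracket. -/
def restrict (S : Subalgebra R A) (hS : ∀ a ∈ S, ∀ b ∈ S, P.bracket a b ∈ S) :
    PoissonStructure R S where
  bracket := LinearMap.mk₂ R (fun a b => ⟨P.bracket a b, hS a a.2 b b.2⟩)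
    (fun a b c => by ext; simp) (fun r a b => by ext; simp)
    (fun a b c => by ext; simp) (fun r a b => by ext; simp)
  self a := by ext; simp [P.self]
  jacobi a b c := by ext; simpa using P.jacobi a b c
  leibniz a b c := by ext; simpa using P.leibniz a b c

variable (J : Ideal A)

theorem mk_bracket_congr (hJ : ∀ a, ∀ j ∈ J, P.bracket a j ∈ J)
    {a a' b b' : A} (ha : Ideal.Quotient.mk J a = Ideal.Quotient.mk J a')
    (hb : Ideal.Quotient.mk J b = Ideal.Quotient.mk J b') :
    Ideal.Quotient.mk J (P.bracket a b) = Ideal.Quotient.mk J (P.bracket a' b') := by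
  rw [Ideal.Quotient.eq] at ha hb ⊢
  -- The difference telescopes as `{a, b - b'} + {a - a', b'}`; skew-symmetry brings the second term
  -- into the form covered by `hJ`.
  have h1 := hJ a _ hb
  have h2 := J.neg_mem (hJ b' _ ha)
  rw [← P.skew] at h2
  have h := J.add_mem h1 h2
  simpa using h

/-- The Poisson structure on the quotient by an ideal stable under the bracket. -/
noncomputable def quotient (hJ : ∀ a, ∀ j ∈ J, P.bracket a j ∈ J) :
    PoissonStructure R (A ⧸ J) :=
  have out : ∀ a : A ⧸ J, Ideal.Quotient.mk J (Quotient.out a) = a := Quotient.out_eq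
  -- The bracket on the quotient is defined through chosen representatives; this independence
  -- reduces every axiom to the one upstairs.
  have key : ∀ a b : A, Ideal.Quotient.mk J
      (P.bracket (Quotient.out (Ideal.Quotient.mk J a)) (Quotient.out (Ideal.Quotient.mk J b))) =
        Ideal.Quotient.mk J (P.bracket a b) := fun a b =>
    P.mk_bracket_congr J hJ (out _) (out _)
  have surj := Ideal.Quotient.mk_surjective (I := J)
  have hsmul : ∀ (r : R) (a : A), r • Ideal.Quotient.mk J a = Ideal.Quotient.mk J (r • a) :=
    fun _ _ => rfl
  let B : A ⧸ J →ₗ[R] A ⧸ J →ₗ[R] A ⧸ J := LinearMap.mk₂ R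
    (fun a b => Ideal.Quotient.mk J (P.bracket (Quotient.out a) (Quotient.out b)))
    (fun a b c => by
      obtain ⟨a, rfl⟩ := surj a
      obtain ⟨b, rfl⟩ := surj b
      obtain ⟨c, rfl⟩ := surj c
      simp only [← map_add (Ideal.Quotient.mk J), key]
      rw [map_add P.bracket, LinearMap.add_apply])
    (fun r a b => by
      obtain ⟨a, rfl⟩ := surj a
      obtain ⟨b, rfl⟩ := surj b
      simp only [hsmul, key, map_smul, LinearMap.smul_apply])
    (fun a b c => by
      obtain ⟨a, rfl⟩ := surj a
      obtain ⟨b, rfl⟩ := surj b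
      obtain ⟨c, rfl⟩ := surj c
      simp only [← map_add, key])
    (fun r a b => by
      obtain ⟨a, rfl⟩ := surj a
      obtain ⟨b, rfl⟩ := surj b
      simp only [hsmul, key, map_smul])
  have hB : ∀ a b : A, B (Ideal.Quotient.mk J a) (Ideal.Quotient.mk J b) =
      Ideal.Quotient.mk J (P.bracket a b) := key
  { bracket := B
    self := fun a => by
      obtain ⟨a, rfl⟩ := surj a
      rw [hB, P.self, map_zero]
    jacobi := fun a b c => by
      obtain ⟨a, rfl⟩ := surj a
      obtain ⟨b, rfl⟩ := surj b
      obtain ⟨c, rfl⟩ := surj c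
      simp only [hB, ← map_add, P.jacobi a b c]
    leibniz := fun a b c => by
      obtain ⟨a, rfl⟩ := surj a
      obtain ⟨b, rfl⟩ := surj b
      obtain ⟨c, rfl⟩ := surj c
      simp only [hB, ← map_add, ← map_mul, P.leibniz a b c] }

theorem quotient_bracket_mk (hJ : ∀ a, ∀ j ∈ J, P.bracket a j ∈ J) (a b : A) :
    (P.quotient J hJ).bracket (Ideal.Quotient.mk J a) (Ideal.Quotient.mk J b) =
      Ideal.Quotient.mk J (P.bracket a b) :=
  P.mk_bracket_congr J hJ (Quotient.out_eq _) (Quotient.out_eq _)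

end PoissonStructure

/-! ### Casimir and first class functions along a subset. -/

section Ideals

variable {E : Type*} [NormedAddCommGroup E] [NormedSpace ℝ E] [FiniteDimensional ℝ E]
  {M : Type*} [TopologicalSpace M] [ChartedSpace E M] [IsManifold 𝓘(ℝ, E) ∞ M]
  (Ω : SymplecticForm E M)

/-- The Poisson structure of a symplectic manifold. -/
noncomputable def poissonStructure : PoissonStructure ℝ (SmoothFunction E M) where
  bracket := poissonBilinear Ω
  self := poissonBracket_self Ω
  jacobi := poissonBracket_jacobi Ω
  leibniz := poissonBracket_mul Ω

theorem poissonBracket_zero_left (h : SmoothFunction E M) : poissonBracket Ω 0 h = 0 :=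
  congrArg (fun l => l h) (map_zero (poissonBilinear Ω))

theorem add_poissonBracket (f g h : SmoothFunction E M) :
    poissonBracket Ω (f + g) h = poissonBracket Ω f h + poissonBracket Ω g h :=
  congrArg (fun l => l h) (map_add (poissonBilinear Ω) f g)

theorem sub_poissonBracket (f g h : SmoothFunction E M) :
    poissonBracket Ω (f - g) h = poissonBracket Ω f h - poissonBracket Ω g h :=
  congrArg (fun l => l h) (map_sub (poissonBilinear Ω) f g)

theorem sum_poissonBracket {ι : Type*} (s : Finset ι) (f : ι → SmoothFunction E M)
    (h : SmoothFunction E M) :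
    poissonBracket Ω (∑ i ∈ s, f i) h = ∑ i ∈ s, poissonBracket Ω (f i) h :=
  map_sum ((poissonBilinear Ω).flip h) f s

theorem poissonBracket_algebraMap (f : SmoothFunction E M) (r : ℝ) :
    poissonBracket Ω f (algebraMap ℝ _ r) = 0 := by
  -- Leibniz on `1 * 1` gives `{f, 1} = 2 {f, 1}`.
  have h := poissonBracket_mul Ω f 1 1
  rw [mul_one, mul_one, one_mul, left_eq_add] at h
  rw [Algebra.algebraMap_eq_smul_one, poissonBracket_smul, h, smul_zero]

variable (N : Set M)

/-- The Casimir functions along `N` which vanish on `N` form an ideal of `C^∞(M)`. -/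
noncomputable def casimirIdeal : Ideal (SmoothFunction E M) where
  carrier := (constraintIdeal E N : Set (SmoothFunction E M)) ∩ casimirs Ω N
  add_mem' := fun {f g} hf hg => ⟨add_mem hf.1 hg.1, fun h => by
    rw [add_poissonBracket]
    exact add_mem (hf.2 h) (hg.2 h)⟩
  zero_mem' := ⟨zero_mem _, fun h => by
    rw [poissonBracket_zero_left]
    exact zero_mem _⟩
  -- The term `f {c, h}` is absorbed because `f` vanishes on `N`. Casimirs alone need not form an
  -- ideal: the constant `1` is one.
  smul_mem' := fun c f hf => ⟨Ideal.mul_mem_left _ c hf.1, fun h => by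
    rw [smul_eq_mul, mul_poissonBracket]
    exact add_mem (Ideal.mul_mem_left _ c (hf.2 h)) (Ideal.mul_mem_right _ _ hf.1)⟩

/-- By Jacobi `{{f, q}, h} = {f, {q, h}} - {q, {f, h}}`: the first term is handled by `f` being
first class, the second by `q` being Casimir. -/
theorem poissonBracket_mem_casimirIdeal {f : SmoothFunction E M} (hf : f ∈ firstClass Ω N)
    {q : SmoothFunction E M} (hq : q ∈ casimirIdeal Ω N) :
    poissonBracket Ω f q ∈ casimirIdeal Ω N := by
  refine ⟨hf q hq.1, fun h => ?_⟩
  have hj := poissonBracket_jacobi Ω f q h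
  rw [← sub_eq_iff_eq_add] at hj
  rw [← hj]
  exact sub_mem (hf _ (hq.2 h)) (hq.2 _)

theorem poissonBracket_mem_firstClass {f g : SmoothFunction E M} (hf : f ∈ firstClass Ω N)
    (hg : g ∈ firstClass Ω N) : poissonBracket Ω f g ∈ firstClass Ω N := by
  intro h hh
  have hj := poissonBracket_jacobi Ω f g h
  rw [← sub_eq_iff_eq_add] at hj
  rw [← hj]
  exact sub_mem (hf _ (hg _ hh)) (hg _ (hf _ hh))

end Ideals

/-! ### The ideal `I_μ + (I_N ∩ Q)` and the subalgebra `F_N ∩ Q'`. -/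

section Reduction

variable {E : Type*} [NormedAddCommGroup E] [NormedSpace ℝ E] [FiniteDimensional ℝ E]
  {M : Type*} [TopologicalSpace M] [ChartedSpace E M] [IsManifold 𝓘(ℝ, E) ∞ M]
  {EG : Type*} [NormedAddCommGroup EG] [NormedSpace ℝ EG]

omit [FiniteDimensional ℝ E] [IsManifold 𝓘(ℝ, E) ∞ M] in
theorem momentumIdeal_le_constraintIdeal (G : Type*) [TopologicalSpace G] [ChartedSpace EG G]
    [Group G] (μ : DualValuedMap E M EG) :
    momentumIdeal G μ ≤ constraintIdeal E (μ ⁻¹' {0}) := by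
  refine Ideal.span_le.2 ?_
  rintro _ ⟨ξ, rfl⟩ x hx
  exact congrArg (fun l : EG →L[ℝ] ℝ => l ξ) hx

/-- The ideal `I_μ + (I_N ∩ Q)` for `N = μ⁻¹(0)`. -/
noncomputable def reductionIdeal (G : Type*) [TopologicalSpace G] [ChartedSpace EG G] [Group G]
    (Ω : SymplecticForm E M) (μ : DualValuedMap E M EG) : Ideal (SmoothFunction E M) :=
  momentumIdeal G μ ⊔ casimirIdeal Ω (μ ⁻¹' {0})

section

variable (G : Type*) [TopologicalSpace G] [ChartedSpace EG G] [Group G]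
  (Ω : SymplecticForm E M) (μ : DualValuedMap E M EG)

theorem coe_reductionIdeal :
    (reductionIdeal G Ω μ : Set (SmoothFunction E M)) =
      (momentumIdeal G μ : Set (SmoothFunction E M)) +
        ((constraintIdeal E (μ ⁻¹' {0}) : Set (SmoothFunction E M)) ∩ casimirs Ω (μ ⁻¹' {0})) :=
  Submodule.coe_sup _ _

/-- The modular law, valid because `I_μ ⊆ I_N`. -/
theorem mem_reductionIdeal_iff (f : SmoothFunction E M) :
    f ∈ reductionIdeal G Ω μ ↔ f ∈ constraintIdeal E (μ ⁻¹' {0}) ∧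
      f ∈ (momentumIdeal G μ : Set (SmoothFunction E M)) + casimirs Ω (μ ⁻¹' {0}) := by
  rw [← SetLike.mem_coe, coe_reductionIdeal, Set.mem_add, Set.mem_add]
  constructor
  · rintro ⟨a, ha, q, hq, rfl⟩
    exact ⟨add_mem (momentumIdeal_le_constraintIdeal G μ ha) hq.1, a, ha, q, hq.2, rfl⟩
  · rintro ⟨hf, a, ha, q, hq, rfl⟩
    exact ⟨a, ha, q,
      ⟨((constraintIdeal E _).add_mem_iff_right (momentumIdeal_le_constraintIdeal G μ ha)).1 hf,
        hq⟩, rfl⟩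

theorem component_mem_reductionIdeal (ξ : GroupLieAlgebra 𝓘(ℝ, EG) G) :
    component μ ξ ∈ reductionIdeal G Ω μ :=
  Ideal.mem_sup_left (Ideal.subset_span ⟨ξ, rfl⟩)

omit [FiniteDimensional ℝ E] [IsManifold 𝓘(ℝ, E) ∞ M] in
theorem component_mem_constraintIdeal (ξ : GroupLieAlgebra 𝓘(ℝ, EG) G) :
    component μ ξ ∈ constraintIdeal E (μ ⁻¹' {0}) :=
  momentumIdeal_le_constraintIdeal G μ (Ideal.subset_span ⟨ξ, rfl⟩)

/-- For first class `f` the bracket with `μ_ξ ∈ I_N` lies in `I_N` anyway. The gain is that `I_μ +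
Q` is replaced by an ideal, from which closure under products follows. -/
theorem mem_firstClass_inter_casimirs'_iff (f : SmoothFunction E M) :
    f ∈ firstClass Ω (μ ⁻¹' {0}) ∩ casimirs' G Ω μ (μ ⁻¹' {0}) ↔
      f ∈ firstClass Ω (μ ⁻¹' {0}) ∧ ∀ ξ : GroupLieAlgebra 𝓘(ℝ, EG) G,
        poissonBracket Ω f (component μ ξ) ∈ reductionIdeal G Ω μ := by
  simp only [mem_reductionIdeal_iff]
  exact ⟨fun h => ⟨h.1, fun ξ => ⟨h.1 _ (component_mem_constraintIdeal G μ ξ), h.2 ξ⟩⟩,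
    fun h => ⟨h.1, fun ξ => (h.2 ξ).2⟩⟩

/-- The subalgebra `F_N ∩ Q'` for `N = μ⁻¹(0)`. -/
noncomputable def reducibleSubalgebra : Subalgebra ℝ (SmoothFunction E M) where
  carrier := {f | f ∈ firstClass Ω (μ ⁻¹' {0}) ∧ ∀ ξ : GroupLieAlgebra 𝓘(ℝ, EG) G,
    poissonBracket Ω f (component μ ξ) ∈ reductionIdeal G Ω μ}
  add_mem' := fun {f g} hf hg => by
    refine ⟨fun h hh => ?_, fun ξ => ?_⟩ <;> rw [add_poissonBracket]
    · exact add_mem (hf.1 h hh) (hg.1 h hh)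
    · exact add_mem (hf.2 ξ) (hg.2 ξ)
  mul_mem' := fun {f g} hf hg => by
    refine ⟨fun h hh => ?_, fun ξ => ?_⟩ <;> rw [mul_poissonBracket]
    · exact add_mem (Ideal.mul_mem_left _ _ (hg.1 h hh)) (Ideal.mul_mem_left _ _ (hf.1 h hh))
    · exact add_mem (Ideal.mul_mem_left _ _ (hg.2 ξ)) (Ideal.mul_mem_left _ _ (hf.2 ξ))
  algebraMap_mem' r := by
    refine ⟨fun h _ => ?_, fun ξ => ?_⟩ <;>
      rw [poissonBracket_skew, poissonBracket_algebraMap, neg_zero] <;> exact zero_mem _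

theorem coe_reducibleSubalgebra :
    (reducibleSubalgebra G Ω μ : Set (SmoothFunction E M)) =
      firstClass Ω (μ ⁻¹' {0}) ∩ casimirs' G Ω μ (μ ⁻¹' {0}) :=
  Set.ext fun f => (mem_firstClass_inter_casimirs'_iff G Ω μ f).symm

variable {G Ω μ}

/-- The derivation `{f, ·}` sends the generators `μ_ξ` of `I_μ` into the ideal by hypothesis, and
Leibniz extends this to their multiples; on `I_N ∩ Q` first-classness suffices. -/
theorem poissonBracket_mem_reductionIdeal {f : SmoothFunction E M}
    (hf : f ∈ reducibleSubalgebra G Ω μ) {k : SmoothFunction E M}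
    (hk : k ∈ reductionIdeal G Ω μ) : poissonBracket Ω f k ∈ reductionIdeal G Ω μ := by
  obtain ⟨a, ha, q, hq, rfl⟩ := Submodule.mem_sup.1 hk
  rw [poissonBracket_add]
  refine add_mem ?_ (Ideal.mem_sup_right (poissonBracket_mem_casimirIdeal Ω _ hf.1 hq))
  clear hk hq
  induction ha using Submodule.span_induction with
  | mem _ h =>
    obtain ⟨ξ, rfl⟩ := h
    exact hf.2 ξ
  | zero =>
    rw [poissonBracket_skew, poissonBracket_zero_left, neg_zero]
    exact zero_mem _
  | add a b _ _ ha hb =>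
    rw [poissonBracket_add]
    exact add_mem ha hb
  | smul c a ha iha =>
    rw [smul_eq_mul, poissonBracket_mul]
    exact add_mem (Ideal.mul_mem_left _ _ (Ideal.mem_sup_left ha)) (Ideal.mul_mem_left _ _ iha)

theorem poissonBracket_mem_reducibleSubalgebra {f g : SmoothFunction E M}
    (hf : f ∈ reducibleSubalgebra G Ω μ) (hg : g ∈ reducibleSubalgebra G Ω μ) :
    poissonBracket Ω f g ∈ reducibleSubalgebra G Ω μ := by
  refine ⟨poissonBracket_mem_firstClass Ω _ hf.1 hg.1, fun ξ => ?_⟩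
  have hj := poissonBracket_jacobi Ω f g (component μ ξ)
  rw [← sub_eq_iff_eq_add] at hj
  rw [← hj]
  exact sub_mem (poissonBracket_mem_reductionIdeal hf (hg.2 ξ))
    (poissonBracket_mem_reductionIdeal hg (hf.2 ξ))

end

/-! ### Reducible and vanishing observables of a moment map. -/

variable {G : Type*} [TopologicalSpace G] [ChartedSpace EG G] [Group G] [LieGroup 𝓘(ℝ, EG) ∞ G]
  [MulAction G M] [ContMDiffSMul 𝓘(ℝ, EG) 𝓘(ℝ, E) ∞ G M]
  {Ω : SymplecticForm E M} {μ : DualValuedMap E M EG}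

theorem IsMomentMap.component_mem_reducibleSubalgebra (hμ : IsMomentMap G Ω μ)
    (ξ : GroupLieAlgebra 𝓘(ℝ, EG) G) : component μ ξ ∈ reducibleSubalgebra G Ω μ := by
  refine ⟨hμ.component_mem_firstClass ξ, fun η => ?_⟩
  obtain ⟨ζ, hζ⟩ := hμ.exists_poissonBracket_component ξ η
  rw [hζ]
  exact component_mem_reductionIdeal G Ω μ ζ

/-- First class functions are not closed under arbitrary multiples, but here the Leibniz error `a
{c, h}` lies in `I_N` because `a` does. -/
theorem IsMomentMap.momentumIdeal_subset_firstClass (hμ : IsMomentMap G Ω μ)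
    {a : SmoothFunction E M} (ha : a ∈ momentumIdeal G μ) : a ∈ firstClass Ω (μ ⁻¹' {0}) := by
  intro h hh
  induction ha using Submodule.span_induction with
  | mem _ h =>
    obtain ⟨ξ, rfl⟩ := h
    exact hμ.component_mem_firstClass ξ _ hh
  | zero =>
    rw [poissonBracket_zero_left]
    exact zero_mem _
  | add a b _ _ ha hb =>
    rw [add_poissonBracket]
    exact add_mem ha hb
  | smul c a ha iha =>
    rw [smul_eq_mul, mul_poissonBracket]
    exact add_mem (Ideal.mul_mem_left _ _ iha)
      (Ideal.mul_mem_right _ _ (momentumIdeal_le_constraintIdeal G μ ha))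

/-- The bracket condition comes from reading `{k, μ_ξ}` as `-{μ_ξ, k}`: each `μ_ξ` lies in the
subalgebra, whose elements preserve the ideal. -/
theorem IsMomentMap.reductionIdeal_subset_reducibleSubalgebra (hμ : IsMomentMap G Ω μ)
    {k : SmoothFunction E M} (hk : k ∈ reductionIdeal G Ω μ) :
    k ∈ reducibleSubalgebra G Ω μ := by
  refine ⟨?_, fun ξ => ?_⟩
  · obtain ⟨a, ha, q, hq, rfl⟩ := Submodule.mem_sup.1 hk
    intro h hh
    rw [add_poissonBracket]
    exact add_mem (hμ.momentumIdeal_subset_firstClass ha h hh) (hq.2 h)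
  · rw [poissonBracket_skew]
    exact neg_mem (poissonBracket_mem_reductionIdeal (hμ.component_mem_reducibleSubalgebra ξ) hk)

theorem IsMomentMap.derivation_fundamentalVectorField (hμ : IsMomentMap G Ω μ)
    (ξ : GroupLieAlgebra 𝓘(ℝ, EG) G) (f : SmoothFunction E M) :
    derivation (fundamentalVectorField ξ) f = poissonBracket Ω (component μ ξ) f := by
  rw [hμ.fundamentalVectorField_eq, poissonBracket_eq_derivation]

/-- A vector field acting on functions as `{g, ·}` lies in the fundamental module plus the vector
fields vanishing along `N = μ⁻¹(0)` exactly when `g` lies in `I_μ + Q`. -/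
theorem IsMomentMap.mem_fundamentalModule_add_vanishingFields_iff (hμ : IsMomentMap G Ω μ)
    {v : SmoothVectorField E M} {g : SmoothFunction E M}
    (hv : ∀ f, derivation v f = poissonBracket Ω g f) :
    v ∈ fundamentalModule (𝔤 := GroupLieAlgebra 𝓘(ℝ, EG) G) fundamentalVectorField +
        vanishingFields (μ ⁻¹' {0}) ↔
      g ∈ (momentumIdeal G μ : Set (SmoothFunction E M)) + casimirs Ω (μ ⁻¹' {0}) := by
  have key : ∀ (n : ℕ) (a : Fin n → SmoothFunction E M)
      (ξ : Fin n → GroupLieAlgebra 𝓘(ℝ, EG) G) (f : SmoothFunction E M),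
      derivation v f - ∑ i, a i * derivation (fundamentalVectorField (ξ i)) f ∈
        constraintIdeal E (μ ⁻¹' {0}) ↔
      poissonBracket Ω (g - ∑ i, a i * component μ (ξ i)) f ∈ constraintIdeal E (μ ⁻¹' {0}) := by
    intro n a ξ f
    -- The discrepancy between `{∑ aᵢ μ_ξᵢ, f}` and `∑ aᵢ {μ_ξᵢ, f}`.
    have h0 : ∑ i, component μ (ξ i) * poissonBracket Ω (a i) f ∈
        constraintIdeal E (μ ⁻¹' {0}) := sum_mem fun i _ =>
      Ideal.mul_mem_right _ _ (component_mem_constraintIdeal G μ (ξ i))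
    simp only [sub_poissonBracket, sum_poissonBracket, mul_poissonBracket, hv,
      hμ.derivation_fundamentalVectorField, Finset.sum_add_distrib]
    rw [← sub_sub]
    exact (Submodule.sub_mem_iff_left _ h0).symm
  rw [mem_fundamentalModule_add_vanishingFields, Set.mem_add]
  simp only [key]
  constructor
  · rintro ⟨n, a, ξ, h⟩
    exact ⟨∑ i, a i * component μ (ξ i),
      sum_mem fun i _ => Ideal.mul_mem_left _ _ (Ideal.subset_span ⟨ξ i, rfl⟩), _, h,
      add_sub_cancel _ _⟩
  · rintro ⟨p, hp, q, hq, rfl⟩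
    obtain ⟨n, a, s, rfl⟩ := Submodule.mem_span_set'.1 hp
    choose ξ hξ using fun i => (s i).2
    refine ⟨n, a, ξ, fun f => ?_⟩
    have he : ∑ i, a i • (s i : SmoothFunction E M) = ∑ i, a i * component μ (ξ i) :=
      Finset.sum_congr rfl fun i _ => by rw [smul_eq_mul, ← hξ i]
    rw [he, add_sub_cancel_left]
    exact hq f

theorem IsMomentMap.LInftyReducible_eq (hμ : IsMomentMap G Ω μ) :
    LInftyReducible (𝔤 := GroupLieAlgebra 𝓘(ℝ, EG) G) fundamentalVectorField (μ ⁻¹' {0}) Ω =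
      firstClass Ω (μ ⁻¹' {0}) ∩ casimirs' G Ω μ (μ ⁻¹' {0}) := by
  have hb : ∀ (f : SmoothFunction E M) (ξ : GroupLieAlgebra 𝓘(ℝ, EG) G) (k : SmoothFunction E M),
      derivation (lieBracket (Ω.hamiltonianVectorField f) (fundamentalVectorField ξ)) k =
        poissonBracket Ω (poissonBracket Ω f (component μ ξ)) k := by
    intro f ξ k
    rw [hμ.fundamentalVectorField_eq, derivation_lieBracket_hamiltonianVectorField,
      poissonBracket_jacobi, add_sub_cancel_right]
  ext f
  constructor
  · rintro ⟨⟨v, f⟩, ⟨ho, ⟨ht, hr⟩, -⟩, rfl⟩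
    obtain rfl := hamiltonianVectorField_unique Ω ho
    refine ⟨fun h hh => ?_, fun ξ =>
      (hμ.mem_fundamentalModule_add_vanishingFields_iff (hb f ξ)).1 (hr ξ)⟩
    rw [poissonBracket_eq_derivation]
    exact ht h hh
  · rintro ⟨hf, hq⟩
    refine ⟨(Ω.hamiltonianVectorField f, f), ⟨hamiltonianVectorField_mem_observables Ω f,
      ⟨fun h hh => ?_, fun ξ =>
        (hμ.mem_fundamentalModule_add_vanishingFields_iff (hb f ξ)).2 (hq ξ)⟩, fun ξ => ?_⟩, rfl⟩
    · rw [← poissonBracket_eq_derivation]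
      exact hf h hh
    -- Reducibility of `f` as a `0`-form is automatic for first class `f`, since `μ_ξ ∈ I_N`.
    · rw [hμ.derivation_fundamentalVectorField, poissonBracket_skew]
      exact neg_mem (hf _ (component_mem_constraintIdeal G μ ξ))

theorem IsMomentMap.LInftyVanishing_eq (hμ : IsMomentMap G Ω μ) :
    LInftyVanishing (𝔤 := GroupLieAlgebra 𝓘(ℝ, EG) G) fundamentalVectorField (μ ⁻¹' {0}) Ω =
      reductionIdeal G Ω μ := by
  have hiff := fun f : SmoothFunction E M => hμ.mem_fundamentalModule_add_vanishingFields_iff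
    fun k => (poissonBracket_eq_derivation Ω f k).symm
  ext f
  rw [SetLike.mem_coe]
  constructor
  · rintro ⟨⟨v, f⟩, ⟨⟨ho, -⟩, hv, hf⟩, rfl⟩
    obtain rfl := hamiltonianVectorField_unique Ω ho
    exact (mem_reductionIdeal_iff G Ω μ f).2 ⟨hf, (hiff f).1 hv⟩
  · intro hf
    -- Vanishing observables are required to be reducible, so the inclusion of the ideal in the
    -- subalgebra is needed here.
    have hL : f ∈ LInftyReducible (𝔤 := GroupLieAlgebra 𝓘(ℝ, EG) G) fundamentalVectorField
        (μ ⁻¹' {0}) Ω := by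
      rw [hμ.LInftyReducible_eq, ← coe_reducibleSubalgebra]
      exact hμ.reductionIdeal_subset_reducibleSubalgebra hf
    obtain ⟨⟨v, f⟩, hr, rfl⟩ := hL
    obtain ⟨hN, hQ⟩ := (mem_reductionIdeal_iff G Ω μ f).1 hf
    obtain rfl := hamiltonianVectorField_unique Ω hr.1
    exact ⟨_, ⟨hr, (hiff f).2 hQ, hN⟩, rfl⟩

end Reduction

end SymplecticReduction
-- The theorem and the reduced Poisson algebra.
open SymplecticReduction in
theorem mainTheorem6
    {E : Type*} [NormedAddCommGroup E] [NormedSpace ℝ E] [FiniteDimensional ℝ E]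
    {M : Type*} [TopologicalSpace M] [ChartedSpace E M] [IsManifold 𝓘(ℝ, E) ∞ M]
    [T2Space M] [ParacompactSpace M]
    {EG : Type*} [NormedAddCommGroup EG] [NormedSpace ℝ EG] [FiniteDimensional ℝ EG]
    {G : Type*} [TopologicalSpace G] [ChartedSpace EG G] [Group G] [LieGroup 𝓘(ℝ, EG) ∞ G]
    [MulAction G M] [ContMDiffSMul 𝓘(ℝ, EG) 𝓘(ℝ, E) ∞ G M]
    (Ω : SymplecticForm E M) (hΩ : IsSymplecticAction G Ω)
    (μ : DualValuedMap E M EG) (hμ : IsMomentMap G Ω μ)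
    (N : Set M) (hN : N = μ ⁻¹' {0})
    (ρ : GroupLieAlgebra 𝓘(ℝ, EG) G → SmoothVectorField E M)
    (hρ : ρ = fundamentalVectorField) :
    LInftyReducible ρ N Ω = firstClass Ω N ∩ casimirs' G Ω μ N ∧
    LInftyVanishing ρ N Ω =
      (momentumIdeal G μ : Set (SmoothFunction E M)) +
        ((constraintIdeal E N : Set (SmoothFunction E M)) ∩ casimirs Ω N) ∧
    ∃ (A : Subalgebra ℝ (SmoothFunction E M)) (J : Ideal A) (P : PoissonStructure ℝ (A ⧸ J)),
      (A : Set (SmoothFunction E M)) = LInftyReducible ρ N Ω ∧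
      Subtype.val '' (J : Set A) = LInftyVanishing ρ N Ω ∧
      (A : Set (SmoothFunction E M)) = firstClass Ω N ∩ casimirs' G Ω μ N ∧
      Subtype.val '' (J : Set A) =
        (momentumIdeal G μ : Set (SmoothFunction E M)) +
          ((constraintIdeal E N : Set (SmoothFunction E M)) ∩ casimirs Ω N) ∧
      ∀ f h : A, ∃ hfh : poissonBracket Ω (f : SmoothFunction E M) h ∈ A,
        P.bracket (Ideal.Quotient.mk J f) (Ideal.Quotient.mk J h) =
          Ideal.Quotient.mk J ⟨poissonBracket Ω f h, hfh⟩ := by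
  subst hN hρ
  have hA : (reducibleSubalgebra G Ω μ : Set (SmoothFunction E M)) =
      LInftyReducible (𝔤 := GroupLieAlgebra 𝓘(ℝ, EG) G) fundamentalVectorField (μ ⁻¹' {0}) Ω := by
    rw [hμ.LInftyReducible_eq, coe_reducibleSubalgebra]
  -- The image of this preimage is the full ideal of `C^∞(M)`, because that ideal is contained in
  -- the subalgebra.
  let J : Ideal (reducibleSubalgebra G Ω μ) :=
    (reductionIdeal G Ω μ).comap (reducibleSubalgebra G Ω μ).val
  have hJ : Subtype.val '' (J : Set (reducibleSubalgebra G Ω μ)) =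
      (reductionIdeal G Ω μ : Set (SmoothFunction E M)) := by
    ext k
    exact ⟨by rintro ⟨k, hk, rfl⟩; exact hk,
      fun hk => ⟨⟨k, hμ.reductionIdeal_subset_reducibleSubalgebra hk⟩, hk, rfl⟩⟩
  let P := (poissonStructure Ω).restrict (reducibleSubalgebra G Ω μ)
    fun _ hf _ hg => poissonBracket_mem_reducibleSubalgebra hf hg
  have hP : ∀ a, ∀ j ∈ J, P.bracket a j ∈ J :=
    fun a _ hj => poissonBracket_mem_reductionIdeal a.2 hj
  refine ⟨hμ.LInftyReducible_eq, ?_, reducibleSubalgebra G Ω μ, J, P.quotient J hP, hA, ?_,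
    coe_reducibleSubalgebra G Ω μ, ?_, fun f h =>
      ⟨poissonBracket_mem_reducibleSubalgebra f.2 h.2, P.quotient_bracket_mk J hP f h⟩⟩
  · rw [hμ.LInftyVanishing_eq, coe_reductionIdeal]
  · rw [hμ.LInftyVanishing_eq, hJ]
  · rw [hJ, coe_reductionIdeal]
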